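/- **Setting.** Let $H_A,H_B,H_E$ be complex Hilbert spaces of arbitrary (possibly infinite) dimension, let $N\ge 1$, and let the $N$ systems of Alice and of Bob be divided into $l\ge1$ blocks. For the systems of block $i$ Alice has a discrete POVM $\{M^{Ai}_x\}_x$ on $H_A$, a region $\Xi(X^i)$ of observed results, and $D^{Ai}=\sum_{x\in\Xi(X^i)}M^{Ai}_x$; let $\tilde D^A$ be a POVM element ($0\le\tilde D^A\le 1$) with $\tilde D^A\ge D^{Ai}$ for all $i$. The accepted results of block $i$ are the elements of $\Xi(X^i)$ and one further symbol with POVM element $\tilde D^A-D^{Ai}$. The same is given for Bob. Let $P_A,P_B$ be the projections onto finite-dimensional subspaces of $H_A,H_B$ (the filters). An attack is a unit vector $\Psi\in H_A^{\otimes N}\otimes H_B^{\otimes N}\otimes H_E$, and $\mathcal S$ is any set of attacks (for instance, all of them); write $\rho_{A^NB^NE^N}=|\Psi\rangle\langle\Psi|$ and $p(\Psi)=\mathrm{tr}[(\tilde D^A\otimes\tilde D^B)^{\otimes N}\rho_{A^NB^NE^N}]$. In protocol 1 all systems of $\Psi$ are measured; $\rho_{X^NY^NE^N}=\rho_{X^NY^NE^N}(\Psi)$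 is the normalized state of the results and of $E$, given that all results are accepted, i.e. proportional to $\sum_{x,y}|x,y\rangle\langle x,y|\otimes \mathrm{tr}_{A^NB^N}\bigl[K_{xy}\rho_{A^NB^NE^N}K_{xy}^\dagger\bigr]$, where $K_{xy}=\bigotimes_k\sqrt{M_{x_k}}\otimes\bigotimes_k\sqrt{M_{y_k}}\otimes 1_E$. In protocol 2 the systems pass the filters first: $\tilde\rho_{X^NY^NE^N}$ is the state obtained in the same way from $((P_A\otimes P_B)^{\otimes N}\otimes 1_E)\Psi$ in place of $\Psi$. (A state that would be conditioned on an event of probability $0$ is read as $0$.) In both protocols the results of the first block are published, and parameter estimation accepts iff they lie in a given set; a given randomized classical processing of the results yields strings $\bar X,\bar Y$ and a public announcement, and $\bar E$ consists of $E$, the published results and the announcement. A given information reconciliation procedure with leakage $\mathrm{leak}_{IR}=\log_2|C|-\inf_{\bar x,\bar y}H_{\min}(C|\bar x,\bar y)$ ($C$ its transcript) is called $\epsilon''$-secure if for all input strings it yields a wrong guess with probability at most $\epsilon''$. $H^{\epsilon'}_{\min}$ is the smooth min-entropy, with smoothing over positive operators $\rho'$ (classical on the same registers) with $\mathrm{tr}\rho'\le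 \mathrm{tr}\rho$ and $\|\rho'-\rho\|_1\le\epsilon'\,\mathrm{tr}\rho$. Given a state $\sigma(\Psi)$ of $X^NY^NE$ and an acceptance probability $a(\Psi)$ for each $\Psi\in\mathcal S$, the *$\epsilon$-secure key rate* is $$\sup\ \frac1N\Bigl(\inf_{\Psi\in\mathcal S,\ a(\Psi)>\epsilon'''}H^{\epsilon'}_{\min}(\sigma(\Psi)_{\bar X\bar E}\,|\,\bar E)-\mathrm{leak}_{IR}\Bigr),$$ the supremum over all $\epsilon',\epsilon'',\epsilon'''\ge0$ with $\epsilon'+\epsilon''+\epsilon'''=\epsilon$ such that the reconciliation is $\epsilon''$-secure. Let $a_1(\Psi)$ be $p(\Psi)$ times the probability that parameter estimation accepts the results of $\rho_{X^NY^NE^N}(\Psi)$, and $a_2(\Psi)$ the probability that it accepts the results of $\tilde\rho_{X^NY^NE^N}(\Psi)$. The rate $R_1$ of protocol 1 is that for $\sigma=\rho_{X^NY^NE^N}$ and $a=a_1$; the rate $R_2$ of protocol 2 with parameter estimation from the data of protocol 1 is that for $\sigma=\tilde\rho_{X^NY^NE^N}$ and $a=a_1$; the rate $R_2^{\mathrm{own}}$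 of protocol 2 with its own data is that for $\sigma=\tilde\rho_{X^NY^NE^N}$ and $a=a_2$. **Theorem 2.** Let $\delta>0$, $\epsilon\ge0$, and suppose that $\|\rho_{X^NY^NE^N}-\tilde\rho_{X^NY^NE^N}\|_1\le2\delta$ for every $\Psi\in\mathcal S$ with $p(\Psi)\ge\delta$. Then the $(5\delta+\epsilon)$-secure key rate of protocol 1 is at least the $(2\delta+\epsilon)$-secure key rate of protocol 2 in which the data of protocol 1 are used for parameter estimation, $R_1(5\delta+\epsilon)\ge R_2(2\delta+\epsilon)$; and the latter is at least the $\epsilon$-secure key rate of protocol 2 with its own data, $R_2(2\delta+\epsilon)\ge R_2^{\mathrm{own}}(\epsilon)$. -/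

import Mathlib

open scoped ENNReal NNReal InnerProductSpace

noncomputable section

namespace QKD

universe u v w a

/-! ### Hilbert spaces, tensor powers, partial trace

Every Hilbert space is `ℓ²(ι)` for the index set `ι` of an orthonormal basis; the index set is
arbitrary, so the dimension is arbitrary, possibly infinite.  The Hilbert tensor product of
`ℓ²(ι)` and `ℓ²(κ)` is `ℓ²(ι × κ)`. -/

/-- The Hilbert space `ℓ²(ι)` over `ℂ`. -/
abbrev L2 (ι : Type*) := lp (fun _ : ι => ℂ) 2

/-- Bounded operators on `ℓ²(ι)`. -/
abbrev Op (ι : Type*) := L2 ι →L[ℂ] L2 ι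

theorem summable_sq {ι : Type*} (f : L2 ι) : Summable fun i => ‖f i‖ ^ (2 : ℝ) := by
  simpa using (lp.memℓp f).summable (by norm_num)

theorem norm_sq_eq {ι : Type*} (f : L2 ι) : ‖f‖ ^ (2 : ℝ) = ∑' i, ‖f i‖ ^ (2 : ℝ) := by
  simpa using lp.norm_rpow_eq_tsum (p := 2) (by norm_num) f

/-- Restriction of `f ∈ ℓ²(ι)` along an injection `κ → ι`. -/
def restrict {ι κ : Type*} (φ : κ → ι) (hφ : Function.Injective φ) : L2 ι →ₗ[ℂ] L2 κ where
  toFun f := ⟨fun j => f (φ j), memℓp_gen (by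
    simpa using! (summable_sq f).comp_injective hφ)⟩
  map_add' _ _ := rfl
  map_smul' _ _ := rfl

/-- For `e : ι ≃ α × ρ` and `r : ρ`, the slice `a ↦ f (a, r)` of `f ∈ ℓ²(ι) = ℓ²(α) ⊗ ℓ²(ρ)`. -/
def slice {ι α ρ : Type*} (e : ι ≃ α × ρ) (r : ρ) : L2 ι →ₗ[ℂ] L2 α :=
  restrict (fun a => e.symm (a, r)) (fun _ _ h => (Prod.ext_iff.1 (e.symm.injective h)).1)

theorem hasSum_slice {ι α ρ : Type*} (e : ι ≃ α × ρ) (f : L2 ι) :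
    HasSum (fun r => ‖slice e r f‖ ^ (2 : ℝ)) (‖f‖ ^ (2 : ℝ)) := by
  have h1 : HasSum (fun i => ‖f i‖ ^ (2 : ℝ)) (‖f‖ ^ (2 : ℝ)) := by
    rw [norm_sq_eq]; exact (summable_sq f).hasSum
  let e' : ρ × α ≃ ι := (Equiv.prodComm ρ α).trans e.symm
  have h2 : HasSum (fun p : ρ × α => ‖f (e' p)‖ ^ (2 : ℝ)) (‖f‖ ^ (2 : ℝ)) :=
    e'.hasSum_iff.2 h1
  refine h2.prod_fiberwise fun r => ?_
  rw [norm_sq_eq]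
  exact (summable_sq (slice e r f)).hasSum

theorem summable_lift {ι α ρ : Type*} (e : ι ≃ α × ρ) (T : Op α) (f : L2 ι) :
    Summable (fun i => ‖T (slice e (e i).2 f) (e i).1‖ ^ (2 : ℝ)) ∧
      ∑' i, ‖T (slice e (e i).2 f) (e i).1‖ ^ (2 : ℝ) ≤ (‖T‖ * ‖f‖) ^ (2 : ℝ) := by
  have hle : ∀ r, ‖T (slice e r f)‖ ^ (2 : ℝ) ≤ ‖T‖ ^ (2 : ℝ) * ‖slice e r f‖ ^ (2 : ℝ) := by
    intro r
    rw [← Real.mul_rpow (norm_nonneg _) (norm_nonneg _)]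
    exact Real.rpow_le_rpow (norm_nonneg _) (T.le_opNorm _) (by norm_num)
  have hs := (hasSum_slice e f).mul_left (‖T‖ ^ (2 : ℝ))
  have hsum : Summable fun r => ‖T (slice e r f)‖ ^ (2 : ℝ) :=
    Summable.of_nonneg_of_le (fun _ => by positivity) hle hs.summable
  let e' : ρ × α ≃ ι := (Equiv.prodComm ρ α).trans e.symm
  have hF : Summable fun p : ρ × α => ‖T (slice e p.1 f) p.2‖ ^ (2 : ℝ) := by
    refine (summable_prod_of_nonneg (fun p => Real.rpow_nonneg (norm_nonneg _) _)).2
      ⟨fun r => summable_sq (T (slice e r f)), ?_⟩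
    exact hsum.congr fun r => norm_sq_eq (T (slice e r f))
  have hcomp : (fun i => ‖T (slice e (e i).2 f) (e i).1‖ ^ (2 : ℝ)) ∘ e'
      = fun p : ρ × α => ‖T (slice e p.1 f) p.2‖ ^ (2 : ℝ) := by
    funext p; simp [e']
  refine ⟨e'.summable_iff.1 (by rw [hcomp]; exact hF), ?_⟩
  rw [← e'.tsum_eq]
  have : ∑' p, ‖T (slice e (e (e' p)).2 f) (e (e' p)).1‖ ^ (2 : ℝ)
      = ∑' p : ρ × α, ‖T (slice e p.1 f) p.2‖ ^ (2 : ℝ) :=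
    tsum_congr fun p => congrFun hcomp p
  rw [this, hF.tsum_prod, Real.mul_rpow (norm_nonneg _) (norm_nonneg _), ← hs.tsum_eq]
  simp only [← norm_sq_eq]
  exact hsum.tsum_le_tsum hle hs.summable

/-- `T ⊗ 1` on `ℓ²(ι) = ℓ²(α) ⊗ ℓ²(ρ)`, where `e : ι ≃ α × ρ`: the operator `T` acts on every
slice `a ↦ f (a, r)`. -/
def liftOp {ι α ρ : Type*} (e : ι ≃ α × ρ) (T : Op α) : Op ι :=
  LinearMap.mkContinuous
    { toFun := fun f => ⟨fun i => T (slice e (e i).2 f) (e i).1, memℓp_gen (by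
        simpa using (summable_lift e T f).1)⟩
      map_add' := fun f g => by ext i; simp only [map_add]; rfl
      map_smul' := fun c f => by ext i; simp only [map_smul]; rfl }
    ‖T‖ (fun f => by
      refine (Real.rpow_le_rpow_iff (norm_nonneg _) (by positivity)
        (by norm_num : (0 : ℝ) < 2)).1 ?_
      rw [norm_sq_eq]
      exact (summable_lift e T f).2)

/-- The positive square root of a positive operator. -/
def opSqrt {H : Type*} [NormedAddCommGroup H] [InnerProductSpace ℂ H] [CompleteSpace H]
    (T : H →L[ℂ] H) : H →L[ℂ] H :=
  CFC.sqrt T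

/-- Index set of an orthonormal basis of `H_A^{⊗N} ⊗ H_B^{⊗N} ⊗ H_E`, for `H_A = ℓ²(α)`,
`H_B = ℓ²(β)`, `H_E = ℓ²(η)`. -/
abbrev Idx (N : ℕ) (α β η : Type*) := (Fin N → α) × ((Fin N → β) × η)

/-- Split off Alice's `k`-th system. -/
def aliceSplit {N : ℕ} (α β η : Type*) (k : Fin N) :
    Idx N α β η ≃ α × (({j // j ≠ k} → α) × ((Fin N → β) × η)) :=
  ((Equiv.funSplitAt k α).prodCongr (Equiv.refl _)).trans (Equiv.prodAssoc _ _ _)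

/-- Split off Bob's `k`-th system. -/
def bobSplit {N : ℕ} (α β η : Type*) (k : Fin N) :
    Idx N α β η ≃ β × (({j // j ≠ k} → β) × ((Fin N → α) × η)) :=
  ((Equiv.prodAssoc _ _ _).symm.trans
    (((Equiv.prodComm _ _).prodCongr (Equiv.refl _)).trans (Equiv.prodAssoc _ _ _))).trans
    (aliceSplit β α η k)

/-- Split off Eve's system. -/
def eveSplit (N : ℕ) (α β η : Type*) :
    Idx N α β η ≃ η × ((Fin N → α) × (Fin N → β)) :=
  (Equiv.prodAssoc _ _ _).symm.trans (Equiv.prodComm _ _)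

/-- `S₁ ⊗ ⋯ ⊗ S_N ⊗ T₁ ⊗ ⋯ ⊗ T_N ⊗ 1_E`, as the product of the (commuting) operators that act
on one system each. -/
def tensorOp {N : ℕ} {α β : Type*} (η : Type*) (S : Fin N → Op α) (T : Fin N → Op β) :
    Op (Idx N α β η) :=
  (List.ofFn fun k => liftOp (aliceSplit α β η k) (S k)).prod *
    (List.ofFn fun k => liftOp (bobSplit α β η k) (T k)).prod

/-- The partial trace `tr_{A^N B^N} |Φ⟩⟨Φ|`, which is the sum of `|Φ_s⟩⟨Φ_s|` over the basis
vectors `s` of `A^N B^N`, where `Φ_s = ⟨s|Φ⟩ ∈ H_E`. -/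
def reducedEve {N : ℕ} {α β η : Type*} (Φ : L2 (Idx N α β η)) : Op η :=
  ∑' s, InnerProductSpace.rankOne ℂ (slice (eveSplit N α β η) s Φ) (slice (eveSplit N α β η) s Φ)

/-! ### Classical-quantum operators, `L₁`-distance, smooth min-entropy -/

open Classical in
/-- The trace of a positive operator on `ℓ²(η)`, in the standard basis. -/
def trace {η : Type*} (T : Op η) : ℝ≥0∞ :=
  ∑' i, ENNReal.ofReal
    (⟪(lp.single 2 i (1 : ℂ) : L2 η), T (lp.single 2 i (1 : ℂ))⟫_ℂ).re

/-- The trace norm (Schatten 1-norm): the supremum of `∑ |⟨e_j, T f_j⟩|` over all finite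
orthonormal systems `e`, `f`. -/
def traceNorm {η : Type*} (T : Op η) : ℝ≥0∞ :=
  ⨆ (n : ℕ) (e : Fin n → L2 η) (f : Fin n → L2 η) (_ : Orthonormal ℂ e) (_ : Orthonormal ℂ f),
    ∑ j, ‖⟪e j, T (f j)⟫_ℂ‖ₑ

/-- A classical-quantum operator `∑_z |z⟩⟨z| ⊗ ρ_z`, with classical register `Z` and quantum
register `ℓ²(η)`, is given by the family `z ↦ ρ_z`. -/
abbrev CQ (Z η : Type*) := Z → Op η

/-- Trace of a positive classical-quantum operator. -/
def CQ.total {Z η : Type*} (ρ : CQ Z η) : ℝ≥0∞ := ∑' z, trace (ρ z)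

/-- The `L₁`-distance `‖ρ - σ‖₁` of classical-quantum operators. -/
def CQ.dist {Z η : Type*} (ρ σ : CQ Z η) : ℝ≥0∞ := ∑' z, traceNorm (ρ z - σ z)

/-- The classical register is processed by the stochastic map `κ`. -/
def CQ.process {Z W η : Type*} (κ : Z → PMF W) (ρ : CQ Z η) : CQ W η :=
  fun w => ∑' z, ((κ z w).toReal : ℂ) • ρ z

/-- The smooth min-entropy `H_min^ε(ρ_{X C E} | C E)` of an operator that is classical on `X`
and `C`: the supremum of all `t` such that `ρ' ≤ 2^{-t} id_X ⊗ σ_{CE}` for some positive `ρ'`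
with `tr ρ' ≤ tr ρ` and `‖ρ' - ρ‖₁ ≤ ε tr ρ`, and some density operator `σ_{CE}`. -/
def smoothMinEntropy {X C η : Type*} (ε : ℝ≥0) (ρ : CQ (X × C) η) : EReal :=
  ⨆ (ρ' : CQ (X × C) η) (σ : CQ C η) (t : ℝ)
    (_ : ∀ z, 0 ≤ ρ' z) (_ : ρ'.total ≤ ρ.total) (_ : ρ'.dist ρ ≤ ε * ρ.total)
    (_ : ∀ c, 0 ≤ σ c) (_ : σ.total = 1)
    (_ : ∀ x c, ρ' (x, c) ≤ (((2 : ℝ) ^ (-t) : ℝ) : ℂ) • σ c), (t : EReal)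

/-! ### Measurements -/

/-- One party's measurements on a single system `ℓ²(α)`: for each of the `l` blocks a POVM, the
region `Ξ i` of the observed results, the element `D i = ∑_{x ∈ Ξ i} M i x` of that region (the
sum converges strongly), and a POVM element `Dt` that dominates all `D i`. -/
structure Measurement (l : ℕ) (α : Type u) where
  Outcome : Fin l → Type v
  M : ∀ i, Outcome i → Op α
  M_nonneg : ∀ i x, 0 ≤ M i x
  M_sum : ∀ i ψ, HasSum (fun x => M i x ψ) ψ
  Ξ : ∀ i, Set (Outcome i)
  D : Fin l → Op α
  D_sum : ∀ i ψ, HasSum (fun x : Ξ i => M i x ψ) (D i ψ)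
  Dt : Op α
  Dt_nonneg : 0 ≤ Dt
  Dt_le_one : Dt ≤ 1
  D_le_Dt : ∀ i, D i ≤ Dt

/-- The accepted results of a system of block `i`: the region `Ξ i` together with one further
symbol `none`. -/
abbrev Measurement.Acc {l : ℕ} {α : Type*} (m : Measurement l α) (i : Fin l) := Option (m.Ξ i)

/-- The POVM elements of the accepted results; the further symbol stands for `Dt - D i`. -/
def Measurement.effect {l : ℕ} {α : Type*} (m : Measurement l α) (i : Fin l) : m.Acc i → Op α
  | some x => m.M i x
  | none => m.Dt - m.D i

/-- Information reconciliation on the strings `x`, `y`: the joint distribution of the public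
transcript and of Bob's guess of `x` (`none` if the parties abort). -/
structure Reconciliation (XK : Type u) (YK : Type v) where
  Transcript : Type w
  [fin : Fintype Transcript]
  run : XK → YK → PMF (Transcript × Option XK)

/-- The reconciliation is `ε`-secure: whatever the strings are, the probability that Bob ends up
with a wrong guess is at most `ε`. -/
def Reconciliation.IsSecure {XK YK : Type*} (R : Reconciliation XK YK) (ε : ℝ≥0) : Prop :=
  ∀ x y, (R.run x y).toOuterMeasure {o | ∃ x', o.2 = some x' ∧ x' ≠ x} ≤ ε

/-- The leakage `log₂ |C| - inf_{x,y} H_min(C | x, y)` of the transcript `C`. -/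
def Reconciliation.leak {XK YK : Type*} (R : Reconciliation XK YK) : ℝ :=
  letI := R.fin
  Real.logb 2 (Fintype.card R.Transcript) -
    ⨅ p : XK × YK, -Real.logb 2 (⨆ c, (((R.run p.1 p.2).map Prod.fst) c).toReal)

/-! ### The two protocols -/

/-- The data common to the two protocols: `N` systems on each side, the assignment of the systems
to `l` blocks (the first of which is used for parameter estimation), the measurements, the
filters, which are projections onto finite-dimensional subspaces, and the classical
post-processing. -/
structure Scheme (N l : ℕ) [NeZero l] (α : Type*) (β : Type*) (XK : Type*) (YK : Type*)
    (C : Type*) where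
  block : Fin N → Fin l
  alice : Measurement.{_, a} l α
  bob : Measurement.{_, a} l β
  filterA : Submodule ℂ (L2 α)
  filterB : Submodule ℂ (L2 β)
  [finA : FiniteDimensional ℂ filterA]
  [finB : FiniteDimensional ℂ filterB]
  /-- The parameter estimation accepts iff the results of the first block lie in this set. -/
  test : Set (∀ k : {k // block k = 0}, alice.Acc (block k) × bob.Acc (block k))
  /-- The (randomized) data processing, which yields Alice's string, Bob's string and a public
  announcement. -/
  proc : (∀ k, alice.Acc (block k)) × (∀ k, bob.Acc (block k)) → PMF (XK × YK × C)
  recon : Reconciliation.{_, _, a} XK YK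

namespace Scheme

variable {N l : ℕ} [NeZero l] {α β XK YK C : Type*} (Q : Scheme N l α β XK YK C)

/-- The accepted results `(x, y)` of all `N` measurements. -/
abbrev Results := (∀ k, Q.alice.Acc (Q.block k)) × (∀ k, Q.bob.Acc (Q.block k))

/-- The published results of the first block. -/
abbrev Published := ∀ k : {k // Q.block k = 0}, Q.alice.Acc (Q.block k) × Q.bob.Acc (Q.block k)

/-- Restriction of the results to the first block. -/
def publish (s : Q.Results) : Q.Published := fun k => (s.1 k, s.2 k)

/-- The measurement operator `⨂_k √M_{x_k} ⊗ ⨂_k √M_{y_k} ⊗ 1_E` of the results `s = (x, y)`. -/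
def kraus (η : Type*) (s : Q.Results) : Op (Idx N α β η) :=
  tensorOp η (fun k => opSqrt (Q.alice.effect (Q.block k) (s.1 k)))
    (fun k => opSqrt (Q.bob.effect (Q.block k) (s.2 k)))

/-- The normalized state of `X^N Y^N E` after the measurement of all systems of the (not
necessarily normalized) pure state `Φ`, given that all results are accepted.  (It is `0` if the
results are accepted with probability `0`.) -/
def measured {η : Type*} (Φ : L2 (Idx N α β η)) : CQ Q.Results η :=
  fun s => (((∑' s', ‖Q.kraus η s' Φ‖ ^ 2)⁻¹ : ℝ) : ℂ) • reducedEve (Q.kraus η s Φ)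

/-- The filter `(P_A ⊗ P_B)^{⊗N} ⊗ 1_E`. -/
def filter (η : Type*) : Op (Idx N α β η) :=
  letI := Q.finA
  letI := Q.finB
  tensorOp η (fun _ => Q.filterA.starProjection) (fun _ => Q.filterB.starProjection)

/-- The state `ρ_{X^N Y^N E}` of protocol 1. -/
def state1 {η : Type*} (Ψ : L2 (Idx N α β η)) : CQ Q.Results η := Q.measured Ψ

/-- The state of `X^N Y^N E` of protocol 2, in which the systems are filtered before they are
measured. -/
def state2 {η : Type*} (Ψ : L2 (Idx N α β η)) : CQ Q.Results η := Q.measured (Q.filter η Ψ)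

/-- `tr[(Dt_A ⊗ Dt_B)^{⊗N} |Ψ⟩⟨Ψ|]`, the probability of results in the observed range. -/
def rangeProb {η : Type*} (Ψ : L2 (Idx N α β η)) : ℝ :=
  (⟪Ψ, tensorOp η (fun _ => Q.alice.Dt) (fun _ => Q.bob.Dt) Ψ⟫_ℂ).re

open Classical in
/-- The probability that the parameter estimation accepts, for the state `ρ` of `X^N Y^N E`. -/
def testProb {η : Type*} (ρ : CQ Q.Results η) : ℝ≥0∞ :=
  ∑' s, if Q.publish s ∈ Q.test then trace (ρ s) else 0

/-- Alice's string together with everything classical that Eve learns: the published results of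
the first block and the announcement of the data processing. -/
def processed {η : Type*} (ρ : CQ Q.Results η) : CQ (XK × (Q.Published × C)) η :=
  ρ.process fun s => (Q.proc s).map fun o => (o.1, (Q.publish s, o.2.2))

/-- The `ε`-secure key rate.  For each attack `Ψ`, `st Ψ` is the state of `X^N Y^N E` from which
the key is generated, and `est Ψ` is the probability that the data used for parameter estimation
are accepted.  The rate is the supremum over all `ε₁ + ε₂ + ε₃ = ε` for which the
reconciliation is `ε₂`-secure of `(H_min^{ε₁}(X|E) - leak) / N`, where the entropy is the worst
case over all attacks that pass the parameter estimation with probability above `ε₃`. -/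
def keyRate {η : Type*} (attacks : Set (L2 (Idx N α β η)))
    (est : L2 (Idx N α β η) → ℝ≥0∞) (st : L2 (Idx N α β η) → CQ Q.Results η)
    (ε : ℝ≥0) : EReal :=
  ⨆ (ε₁ : ℝ≥0) (ε₂ : ℝ≥0) (ε₃ : ℝ≥0) (_ : ε₁ + ε₂ + ε₃ = ε) (_ : Q.recon.IsSecure ε₂),
    ((⨅ Ψ ∈ attacks, ⨅ (_ : (ε₃ : ℝ≥0∞) < est Ψ),
      smoothMinEntropy ε₁ (Q.processed (st Ψ))) - (Q.recon.leak : EReal)) / (N : EReal)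

/-- The probability that the data of protocol 1 lie in the observed range and pass the parameter
estimation. -/
def est1 {η : Type*} (Ψ : L2 (Idx N α β η)) : ℝ≥0∞ :=
  ENNReal.ofReal (Q.rangeProb Ψ) * Q.testProb (Q.state1 Ψ)

/-- The `ε`-secure key rate of protocol 1. -/
def keyRate1 {η : Type*} (attacks : Set (L2 (Idx N α β η))) (ε : ℝ≥0) : EReal :=
  Q.keyRate attacks Q.est1 Q.state1 ε

/-- The `ε`-secure key rate of protocol 2 when the data of protocol 1 are used in place of those
of protocol 2 for the parameter estimation. -/
def keyRate2 {η : Type*} (attacks : Set (L2 (Idx N α β η))) (ε : ℝ≥0) : EReal :=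
  Q.keyRate attacks Q.est1 Q.state2 ε

/-- The `ε`-secure key rate of protocol 2 when its own data (of the systems that pass the filter,
with results in the observed range) are used for the parameter estimation. -/
def keyRate2Own {η : Type*} (attacks : Set (L2 (Idx N α β η))) (ε : ℝ≥0) : EReal :=
  Q.keyRate attacks (fun Ψ => Q.testProb (Q.state2 Ψ)) Q.state2 ε

end Scheme

end QKD

end

/-! The measured states of the two protocols, conditioned on acceptance, have trace `0` or `1`.
Classical post-processing does not increase the trace norm, so states at `L₁`-distance at most
`2δ` remain so after the processing, and a state that is optimal in the smooth min-entropy of one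
with smoothing `ε'` is admissible for the other with smoothing `ε' + 2δ`.  Likewise the
probabilities with which the parameter estimation accepts two such states differ by at most `2δ`.
The distance is controlled only if the observed range has probability at least `δ`; attacks with a
smaller probability are discarded by raising the acceptance threshold `ε'''` by `δ`. -/

namespace QKD

section Operator

variable {H : Type*} [NormedAddCommGroup H] [InnerProductSpace ℂ H]

theorem ofReal_smul_nonneg {c : ℝ} (hc : 0 ≤ c) {T : H →L[ℂ] H} (hT : 0 ≤ T) :
    0 ≤ (c : ℂ) • T := by
  rw [ContinuousLinearMap.nonneg_iff_isPositive] at hT ⊢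
  exact hT.smul_of_nonneg (Complex.zero_le_real.2 hc)

theorem rankOne_self_nonneg (v : H) : 0 ≤ InnerProductSpace.rankOne ℂ v v :=
  (ContinuousLinearMap.nonneg_iff_isPositive _).2 (InnerProductSpace.isPositive_rankOne_self v)

variable [CompleteSpace H]

theorem star_opSqrt (T : H →L[ℂ] H) : star (opSqrt T) = opSqrt T :=
  (CFC.sqrt_nonneg T).isSelfAdjoint.star_eq

theorem opSqrt_mul_self {T : H →L[ℂ] H} (hT : 0 ≤ T) : opSqrt T * opSqrt T = T :=
  CFC.sqrt_mul_sqrt_self T hT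

end Operator

section Trace

variable {ι κ η : Type*}

theorem tsum_enorm_sq_eq {E F : Type*} [SeminormedAddCommGroup E] [SeminormedAddCommGroup F]
    {f : ι → E} {v : F} (h : HasSum (fun i => ‖f i‖ ^ 2) (‖v‖ ^ 2)) :
    ∑' i, ‖f i‖ₑ ^ 2 = ‖v‖ₑ ^ 2 := by
  simp only [← ofReal_norm, ← ENNReal.ofReal_pow (norm_nonneg _)]
  rw [← h.tsum_eq, ENNReal.ofReal_tsum_of_nonneg (fun _ => by positivity) h.summable]

theorem tsum_enorm_inner_sq {E : Type*} [NormedAddCommGroup E] [InnerProductSpace ℂ E]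
    (b : HilbertBasis ι ℂ E) (v : E) : ∑' i, ‖⟪b i, v⟫_ℂ‖ₑ ^ 2 = ‖v‖ₑ ^ 2 := by
  have h := lp.hasSum_norm (p := 2) (by norm_num) (b.repr v)
  simp only [b.repr_apply_apply, b.repr.norm_map] at h
  exact tsum_enorm_sq_eq (by simpa using h)

/-- The standard basis `(e_i)` of `ℓ²(η)`, in which the trace is defined. -/
noncomputable def stdBasis (η : Type*) : HilbertBasis η ℂ (L2 η) :=
  HilbertBasis.ofRepr (LinearIsometryEquiv.refl ℂ (L2 η))

theorem trace_eq_tsum_inner (T : Op η) :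
    trace T = ∑' i, ENNReal.ofReal (⟪stdBasis η i, T (stdBasis η i)⟫_ℂ).re := by
  classical
  simp only [← HilbertBasis.repr_symm_single]
  unfold trace
  congr!

theorem trace_smul {c : ℝ} (hc : 0 ≤ c) (T : Op η) :
    trace ((c : ℂ) • T) = ENNReal.ofReal c * trace T := by
  simp only [trace_eq_tsum_inner, smul_apply, inner_smul_right, Complex.re_ofReal_mul,
    ENNReal.ofReal_mul hc, ENNReal.tsum_mul_left]

theorem trace_add_le (S T : Op η) : trace (S + T) ≤ trace S + trace T := by
  simp only [trace_eq_tsum_inner, add_apply, inner_add_right, Complex.add_re]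
  rw [← ENNReal.tsum_add]
  exact ENNReal.tsum_le_tsum fun i => ENNReal.ofReal_add_le

theorem hasSum_inner_apply {T : κ → Op η} (hT : Summable T) (x y : L2 η) :
    HasSum (fun z => ⟪x, T z y⟫_ℂ) ⟪x, (∑' z, T z) y⟫_ℂ :=
  ((innerSL ℂ x).comp (ContinuousLinearMap.apply ℂ (L2 η) y)).hasSum hT.hasSum

theorem trace_tsum {T : κ → Op η} (hT : Summable T) (h0 : ∀ z, 0 ≤ T z) :
    trace (∑' z, T z) = ∑' z, trace (T z) := by
  simp only [trace_eq_tsum_inner]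
  rw [ENNReal.tsum_comm]
  refine tsum_congr fun i => ?_
  have hsum := Complex.hasSum_re (hasSum_inner_apply hT (stdBasis η i) (stdBasis η i))
  rw [← hsum.tsum_eq]
  exact ENNReal.ofReal_tsum_of_nonneg (fun z =>
    ((ContinuousLinearMap.nonneg_iff_isPositive _).1 (h0 z)).re_inner_nonneg_right _) hsum.summable

theorem trace_rankOne_self (v : L2 η) :
    trace (InnerProductSpace.rankOne ℂ v v) = ‖v‖ₑ ^ 2 := by
  rw [trace_eq_tsum_inner, ← tsum_enorm_inner_sq (stdBasis η) v]
  refine tsum_congr fun i => ?_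
  rw [InnerProductSpace.rankOne_apply, inner_smul_right, ← RCLike.re_eq_complex_re,
    inner_mul_symm_re_eq_norm, norm_mul, norm_inner_symm, ← sq, ENNReal.ofReal_pow (norm_nonneg _),
    ofReal_norm]

theorem trace_star_mul_self (S : Op η) : trace (star S * S) = ∑' i, ‖S (stdBasis η i)‖ₑ ^ 2 := by
  rw [trace_eq_tsum_inner]
  refine tsum_congr fun i => ?_
  rw [mul_apply_eq_comp, ContinuousLinearMap.star_eq_adjoint,
    ContinuousLinearMap.adjoint_inner_right, ← RCLike.re_eq_complex_re, inner_self_eq_norm_sq,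
    ENNReal.ofReal_pow (norm_nonneg _), ofReal_norm]

theorem enorm_star_apply_sq_le (S : Op η) (x : L2 η) :
    ‖star S x‖ₑ ^ 2 ≤ trace (star S * S) * ‖x‖ₑ ^ 2 := by
  rw [trace_star_mul_self, ← tsum_enorm_inner_sq (stdBasis η), ← ENNReal.tsum_mul_right]
  refine ENNReal.tsum_le_tsum fun i => ?_
  rw [ContinuousLinearMap.star_eq_adjoint, ContinuousLinearMap.adjoint_inner_right, ← mul_pow]
  gcongr
  simpa only [enorm, ← ENNReal.coe_mul, ENNReal.coe_le_coe] using nnnorm_inner_le_nnnorm _ x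

theorem enorm_le_trace {T : Op η} (hT : 0 ≤ T) : ‖T‖ₑ ≤ trace T := by
  set S := opSqrt T
  have hstar : star S = S := star_opSqrt T
  have hmul : S * S = T := opSqrt_mul_self hT
  have hS (x : L2 η) : ‖S x‖ₑ ^ 2 ≤ trace T * ‖x‖ₑ ^ 2 := by
    simpa only [hstar, hmul] using enorm_star_apply_sq_le S x
  refine ContinuousLinearMap.opENorm_le_bound T fun x => ?_
  refine (ENNReal.pow_le_pow_left_iff two_ne_zero).1 ?_
  calc ‖T x‖ₑ ^ 2 = ‖S (S x)‖ₑ ^ 2 := by rw [← mul_apply_eq_comp, hmul]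
    _ ≤ trace T * ‖S x‖ₑ ^ 2 := hS _
    _ ≤ trace T * (trace T * ‖x‖ₑ ^ 2) := by gcongr; exact hS x
    _ = (trace T * ‖x‖ₑ) ^ 2 := by ring

end Trace

section TraceNorm

variable {κ η : Type*}

theorem sum_enorm_inner_le_traceNorm (T : Op η) {n : ℕ} {e f : Fin n → L2 η}
    (he : Orthonormal ℂ e) (hf : Orthonormal ℂ f) :
    ∑ j, ‖⟪e j, T (f j)⟫_ℂ‖ₑ ≤ traceNorm T :=
  le_iSup₂_of_le n e (le_iSup₂_of_le f he (le_iSup_of_le hf le_rfl))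

theorem traceNorm_le {T : Op η} {b : ℝ≥0∞}
    (h : ∀ (n : ℕ) (e f : Fin n → L2 η), Orthonormal ℂ e → Orthonormal ℂ f →
      ∑ j, ‖⟪e j, T (f j)⟫_ℂ‖ₑ ≤ b) : traceNorm T ≤ b :=
  iSup₂_le fun n e => iSup₂_le fun f he => iSup_le fun hf => h n e f he hf

theorem traceNorm_neg (T : Op η) : traceNorm (-T) = traceNorm T := by
  simp [traceNorm]

theorem traceNorm_add_le (S T : Op η) : traceNorm (S + T) ≤ traceNorm S + traceNorm T := by
  refine traceNorm_le fun n e f he hf => ?_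
  calc ∑ j, ‖⟪e j, (S + T) (f j)⟫_ℂ‖ₑ
      ≤ ∑ j, (‖⟪e j, S (f j)⟫_ℂ‖ₑ + ‖⟪e j, T (f j)⟫_ℂ‖ₑ) := by
        refine Finset.sum_le_sum fun j _ => ?_
        rw [add_apply, inner_add_right]
        exact enorm_add_le _ _
    _ ≤ traceNorm S + traceNorm T := by
        rw [Finset.sum_add_distrib]
        exact add_le_add (sum_enorm_inner_le_traceNorm S he hf)
          (sum_enorm_inner_le_traceNorm T he hf)

theorem traceNorm_smul_le (c : ℂ) (T : Op η) : traceNorm (c • T) ≤ ‖c‖ₑ * traceNorm T := by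
  refine traceNorm_le fun n e f he hf => ?_
  simp only [smul_apply, inner_smul_right, enorm_mul, ← Finset.mul_sum]
  gcongr
  exact sum_enorm_inner_le_traceNorm T he hf

theorem traceNorm_tsum_le {T : κ → Op η} (hT : Summable T) :
    traceNorm (∑' z, T z) ≤ ∑' z, traceNorm (T z) := by
  refine traceNorm_le fun n e f he hf => ?_
  calc ∑ j, ‖⟪e j, (∑' z, T z) (f j)⟫_ℂ‖ₑ
      ≤ ∑ j, ∑' z, ‖⟪e j, T z (f j)⟫_ℂ‖ₑ := by
        refine Finset.sum_le_sum fun j _ => ?_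
        rw [← (hasSum_inner_apply hT (e j) (f j)).tsum_eq]
        exact enorm_tsum_le_tsum_enorm
    _ = ∑' z, ∑ j, ‖⟪e j, T z (f j)⟫_ℂ‖ₑ :=
        (Summable.tsum_finsetSum fun _ _ => ENNReal.summable).symm
    _ ≤ ∑' z, traceNorm (T z) :=
        ENNReal.tsum_le_tsum fun z => sum_enorm_inner_le_traceNorm (T z) he hf

theorem trace_le_traceNorm (T : Op η) : trace T ≤ traceNorm T := by
  rw [trace_eq_tsum_inner, ENNReal.tsum_eq_iSup_sum]
  refine iSup_le fun s => ?_
  have hs : Orthonormal ℂ fun j => stdBasis η (s.equivFin.symm j) :=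
    (stdBasis η).orthonormal.comp _ (Subtype.val_injective.comp s.equivFin.symm.injective)
  calc ∑ i ∈ s, ENNReal.ofReal (⟪stdBasis η i, T (stdBasis η i)⟫_ℂ).re
      ≤ ∑ i ∈ s, ‖⟪stdBasis η i, T (stdBasis η i)⟫_ℂ‖ₑ := by
        refine Finset.sum_le_sum fun i _ => ?_
        rw [← ofReal_norm]
        exact ENNReal.ofReal_le_ofReal (Complex.re_le_norm _)
    _ = ∑ j, ‖⟪stdBasis η (s.equivFin.symm j), T (stdBasis η (s.equivFin.symm j))⟫_ℂ‖ₑ := by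
        rw [← Finset.sum_coe_sort s, ← s.equivFin.symm.sum_comp]
    _ ≤ traceNorm T := sum_enorm_inner_le_traceNorm T hs hs

theorem trace_le_trace_add_traceNorm_sub (S T : Op η) :
    trace S ≤ trace T + traceNorm (S - T) :=
  calc trace S = trace (T + (S - T)) := by rw [add_sub_cancel]
    _ ≤ trace T + trace (S - T) := trace_add_le _ _
    _ ≤ trace T + traceNorm (S - T) := by gcongr; exact trace_le_traceNorm _

end TraceNorm

namespace CQ

variable {Z W X C η : Type*}

/-- A positive classical-quantum operator of finite trace, that is, a state that need not be
normalized. -/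
structure IsPosTraceClass (ρ : CQ Z η) : Prop where
  nonneg : ∀ z, 0 ≤ ρ z
  total_ne_top : ρ.total ≠ ∞

theorem IsPosTraceClass.summable_norm {ρ : CQ Z η} (hρ : ρ.IsPosTraceClass) :
    Summable fun z => ‖ρ z‖ :=
  tsum_enorm_ne_top_iff_summable_norm.1 <| ne_top_of_le_ne_top hρ.total_ne_top <|
    ENNReal.tsum_le_tsum fun z => enorm_le_trace (hρ.nonneg z)

theorem dist_comm (ρ σ : CQ Z η) : ρ.dist σ = σ.dist ρ := by
  refine tsum_congr fun z => ?_
  rw [← traceNorm_neg, neg_sub]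

theorem dist_triangle (ρ σ τ : CQ Z η) : ρ.dist τ ≤ ρ.dist σ + σ.dist τ := by
  unfold dist
  rw [← ENNReal.tsum_add]
  refine ENNReal.tsum_le_tsum fun z => ?_
  rw [← sub_add_sub_cancel (ρ z) (σ z) (τ z)]
  exact traceNorm_add_le _ _

theorem summable_process {ρ : CQ Z η} (hρ : Summable fun z => ‖ρ z‖) (κ : Z → PMF W) (w : W) :
    Summable fun z => ((κ z w).toReal : ℂ) • ρ z := by
  refine Summable.of_norm_bounded hρ fun z => ?_
  rw [norm_smul, Complex.norm_real, Real.norm_of_nonneg ENNReal.toReal_nonneg]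
  refine mul_le_of_le_one_left (norm_nonneg _) ?_
  exact ENNReal.toReal_le_of_le_ofReal zero_le_one (by simpa using (κ z).coe_le_one w)

theorem tsum_tsum_pmf_mul (κ : Z → PMF W) (g : Z → ℝ≥0∞) :
    ∑' w, ∑' z, κ z w * g z = ∑' z, g z := by
  rw [ENNReal.tsum_comm]
  refine tsum_congr fun z => ?_
  rw [ENNReal.tsum_mul_right, (κ z).tsum_coe, one_mul]

theorem IsPosTraceClass.total_process {ρ : CQ Z η} (hρ : ρ.IsPosTraceClass) (κ : Z → PMF W) :
    (ρ.process κ).total = ρ.total := by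
  unfold total process
  rw [← tsum_tsum_pmf_mul κ]
  refine tsum_congr fun w => ?_
  have h0 (z : Z) : 0 ≤ ((κ z w).toReal : ℂ) • ρ z :=
    ofReal_smul_nonneg ENNReal.toReal_nonneg (hρ.nonneg z)
  rw [trace_tsum (summable_process hρ.summable_norm κ w) h0]
  refine tsum_congr fun z => ?_
  rw [trace_smul ENNReal.toReal_nonneg, ENNReal.ofReal_toReal ((κ z).apply_ne_top w)]

theorem dist_process_le {ρ σ : CQ Z η} (hρ : Summable fun z => ‖ρ z‖)
    (hσ : Summable fun z => ‖σ z‖) (κ : Z → PMF W) :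
    (ρ.process κ).dist (σ.process κ) ≤ ρ.dist σ := by
  unfold dist process
  rw [← tsum_tsum_pmf_mul κ fun z => traceNorm (ρ z - σ z)]
  refine ENNReal.tsum_le_tsum fun w => ?_
  have hρw := summable_process hρ κ w
  have hσw := summable_process hσ κ w
  rw [← hρw.tsum_sub hσw]
  refine (traceNorm_tsum_le (hρw.sub hσw)).trans (ENNReal.tsum_le_tsum fun z => ?_)
  rw [← smul_sub]
  refine (traceNorm_smul_le _ _).trans_eq ?_
  rw [← ofReal_norm, Complex.norm_real, Real.norm_of_nonneg ENNReal.toReal_nonneg,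
    ENNReal.ofReal_toReal ((κ z).apply_ne_top w)]

theorem smoothMinEntropy_le_of_dist_le {ε δ : ℝ≥0} {ρ σ : CQ (X × C) η}
    (htot : ρ.total ≤ σ.total) (hdist : ρ.dist σ ≤ δ * σ.total) :
    smoothMinEntropy ε ρ ≤ smoothMinEntropy (ε + δ) σ := by
  refine iSup₂_le fun ρ' τ => iSup₂_le fun t hρ' => iSup₂_le fun hρ'tot hρ'dist =>
    iSup₂_le fun hτ hτtot => iSup_le fun hle => ?_
  have hdist' : ρ'.dist σ ≤ (ε + δ : ℝ≥0) * σ.total :=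
    calc ρ'.dist σ ≤ ρ'.dist ρ + ρ.dist σ := dist_triangle _ _ _
      _ ≤ ε * σ.total + δ * σ.total :=
          add_le_add (hρ'dist.trans (by gcongr)) hdist
      _ = (ε + δ : ℝ≥0) * σ.total := by rw [← add_mul, ENNReal.coe_add]
  exact le_iSup₂_of_le ρ' τ <| le_iSup₂_of_le t hρ' <| le_iSup₂_of_le (hρ'tot.trans htot) hdist' <|
    le_iSup₂_of_le hτ hτtot <| le_iSup_of_le hle le_rfl

theorem smoothMinEntropy_process_le {ε δ : ℝ≥0} {ρ σ : CQ Z η} (hρ : ρ.IsPosTraceClass)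
    (hσ : σ.IsPosTraceClass) (htot : ρ.total ≤ σ.total) (hdist : ρ.dist σ ≤ δ * σ.total)
    (κ : Z → PMF (X × C)) :
    smoothMinEntropy ε (ρ.process κ) ≤ smoothMinEntropy (ε + δ) (σ.process κ) := by
  refine smoothMinEntropy_le_of_dist_le ?_ ?_
  · rwa [hρ.total_process, hσ.total_process]
  · rw [hσ.total_process]
    exact (dist_process_le hρ.summable_norm hσ.summable_norm κ).trans hdist

end CQ

section ReducedEve

variable {N : ℕ} {α β η : Type*}

theorem summable_rankOne_slice (Φ : L2 (Idx N α β η)) :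
    Summable fun s => InnerProductSpace.rankOne ℂ (slice (eveSplit N α β η) s Φ)
      (slice (eveSplit N α β η) s Φ) := by
  refine .of_norm ?_
  simp only [InnerProductSpace.norm_rankOne, ← sq]
  simpa using (hasSum_slice (eveSplit N α β η) Φ).summable

theorem reducedEve_nonneg (Φ : L2 (Idx N α β η)) : 0 ≤ reducedEve Φ :=
  tsum_nonneg fun _ => rankOne_self_nonneg _

theorem trace_reducedEve (Φ : L2 (Idx N α β η)) : trace (reducedEve Φ) = ‖Φ‖ₑ ^ 2 := by
  rw [reducedEve, trace_tsum (summable_rankOne_slice Φ) fun _ => rankOne_self_nonneg _]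
  simp only [trace_rankOne_self]
  exact tsum_enorm_sq_eq (by simpa using hasSum_slice (eveSplit N α β η) Φ)

end ReducedEve

theorem norm_liftOp_le {ι α ρ : Type*} (e : ι ≃ α × ρ) (T : Op α) : ‖liftOp e T‖ ≤ ‖T‖ :=
  LinearMap.mkContinuous_norm_le _ (norm_nonneg _) _

theorem norm_list_prod_le_one {ι : Type*} {L : List (Op ι)} (hL : ∀ T ∈ L, ‖T‖ ≤ 1) :
    ‖L.prod‖ ≤ 1 :=
  List.prod_induction (‖·‖ ≤ 1)
    (fun S T hS hT => (norm_mul_le S T).trans (mul_le_one₀ hS (norm_nonneg T) hT))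
    ContinuousLinearMap.norm_id_le hL

theorem norm_tensorOp_le_one {N : ℕ} {α β : Type*} (η : Type*) {S : Fin N → Op α}
    {T : Fin N → Op β} (hS : ∀ k, ‖S k‖ ≤ 1) (hT : ∀ k, ‖T k‖ ≤ 1) :
    ‖tensorOp η S T‖ ≤ 1 := by
  refine (norm_mul_le _ _).trans (mul_le_one₀ ?_ (norm_nonneg _) ?_)
  · exact norm_list_prod_le_one <| List.forall_mem_ofFn_iff.2 fun k =>
      (norm_liftOp_le _ _).trans (hS k)
  · exact norm_list_prod_le_one <| List.forall_mem_ofFn_iff.2 fun k =>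
      (norm_liftOp_le _ _).trans (hT k)

theorem Measurement.norm_Dt_le_one {l : ℕ} {α : Type*} (m : Measurement l α) : ‖m.Dt‖ ≤ 1 :=
  (CStarAlgebra.norm_le_one_iff_of_nonneg m.Dt m.Dt_nonneg).2 m.Dt_le_one

namespace Scheme

variable {N l : ℕ} [NeZero l] {α β η XK YK C : Type*} (Q : Scheme N l α β XK YK C)
  {attacks : Set (L2 (Idx N α β η))}

theorem rangeProb_le_norm_sq (Ψ : L2 (Idx N α β η)) : Q.rangeProb Ψ ≤ ‖Ψ‖ ^ 2 := by
  set D := tensorOp η (fun _ : Fin N => Q.alice.Dt) (fun _ : Fin N => Q.bob.Dt)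
  have hD : ‖D‖ ≤ 1 :=
    norm_tensorOp_le_one η (fun _ => Q.alice.norm_Dt_le_one) fun _ => Q.bob.norm_Dt_le_one
  calc Q.rangeProb Ψ ≤ ‖⟪Ψ, D Ψ⟫_ℂ‖ := Complex.re_le_norm _
    _ ≤ ‖Ψ‖ * ‖D Ψ‖ := norm_inner_le_norm _ _
    _ ≤ ‖Ψ‖ * ‖Ψ‖ := by gcongr; exact D.le_of_opNorm_le_of_le hD le_rfl |>.trans_eq (one_mul _)
    _ = ‖Ψ‖ ^ 2 := (sq _).symm

theorem inv_tsum_norm_sq_kraus_nonneg (Φ : L2 (Idx N α β η)) :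
    0 ≤ (∑' s, ‖Q.kraus η s Φ‖ ^ 2)⁻¹ :=
  inv_nonneg.2 (tsum_nonneg fun _ => by positivity)

theorem measured_nonneg (Φ : L2 (Idx N α β η)) (s : Q.Results) : 0 ≤ Q.measured Φ s :=
  ofReal_smul_nonneg (Q.inv_tsum_norm_sq_kraus_nonneg Φ) (reducedEve_nonneg _)

theorem total_measured_eq_zero_or_one (Φ : L2 (Idx N α β η)) :
    (Q.measured Φ).total = 0 ∨ (Q.measured Φ).total = 1 := by
  set p := ∑' s, ‖Q.kraus η s Φ‖ ^ 2 with hp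
  have htotal : (Q.measured Φ).total = ENNReal.ofReal p⁻¹ * ∑' s, ‖Q.kraus η s Φ‖ₑ ^ 2 := by
    simp only [CQ.total, measured, trace_smul (Q.inv_tsum_norm_sq_kraus_nonneg Φ),
      trace_reducedEve, ENNReal.tsum_mul_left, p]
  rcases eq_or_ne p 0 with h0 | h0
  · left
    rw [htotal, h0, inv_zero, ENNReal.ofReal_zero, zero_mul]
  · right
    have hs : Summable fun s => ‖Q.kraus η s Φ‖ ^ 2 := by
      by_contra hs
      exact h0 (tsum_eq_zero_of_not_summable hs)
    have hpe : ∑' s, ‖Q.kraus η s Φ‖ₑ ^ 2 = ENNReal.ofReal p := by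
      rw [hp, ENNReal.ofReal_tsum_of_nonneg (fun _ => by positivity) hs]
      simp only [ENNReal.ofReal_pow (norm_nonneg _), ofReal_norm]
    rw [htotal, hpe, ← ENNReal.ofReal_mul (Q.inv_tsum_norm_sq_kraus_nonneg Φ),
      inv_mul_cancel₀ h0, ENNReal.ofReal_one]

theorem total_measured_le_one (Φ : L2 (Idx N α β η)) : (Q.measured Φ).total ≤ 1 := by
  rcases Q.total_measured_eq_zero_or_one Φ with h | h <;> simp [h]

theorem isPosTraceClass_measured (Φ : L2 (Idx N α β η)) : (Q.measured Φ).IsPosTraceClass where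
  nonneg := Q.measured_nonneg Φ
  total_ne_top := ne_top_of_le_ne_top ENNReal.one_ne_top (Q.total_measured_le_one Φ)

theorem testProb_le_total (ρ : CQ Q.Results η) : Q.testProb ρ ≤ ρ.total :=
  ENNReal.tsum_le_tsum fun s => by split_ifs <;> simp

theorem testProb_le_testProb_add_dist (ρ σ : CQ Q.Results η) :
    Q.testProb ρ ≤ Q.testProb σ + ρ.dist σ := by
  unfold testProb CQ.dist
  rw [← ENNReal.tsum_add]
  refine ENNReal.tsum_le_tsum fun s => ?_
  split_ifs
  · exact trace_le_trace_add_traceNorm_sub _ _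
  · exact zero_le

theorem est1_le_rangeProb (Ψ : L2 (Idx N α β η)) :
    Q.est1 Ψ ≤ ENNReal.ofReal (Q.rangeProb Ψ) :=
  mul_le_of_le_one_right' ((Q.testProb_le_total _).trans (Q.total_measured_le_one Ψ))

theorem lt_rangeProb_of_lt_est1 {Ψ : L2 (Idx N α β η)} {b : ℝ≥0} (h : b < Q.est1 Ψ) :
    b < Q.rangeProb Ψ := by
  have h' := h.trans_le (Q.est1_le_rangeProb Ψ)
  rw [← ENNReal.ofReal_coe_nnreal] at h'
  exact (ENNReal.ofReal_lt_ofReal_iff'.1 h').1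

theorem est1_le_testProb {Ψ : L2 (Idx N α β η)} (hΨ : ‖Ψ‖ ≤ 1) :
    Q.est1 Ψ ≤ Q.testProb (Q.state1 Ψ) :=
  mul_le_of_le_one_left' <| ENNReal.ofReal_le_one.2 <|
    (Q.rangeProb_le_norm_sq Ψ).trans (pow_le_one₀ (norm_nonneg Ψ) hΨ)

theorem total_state1_eq_one {Ψ : L2 (Idx N α β η)} (h : Q.est1 Ψ ≠ 0) :
    (Q.state1 Ψ).total = 1 := by
  refine (Q.total_measured_eq_zero_or_one Ψ).resolve_left fun h0 => h ?_
  have htest : Q.testProb (Q.state1 Ψ) = 0 :=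
    le_antisymm ((Q.testProb_le_total _).trans_eq h0) zero_le
  rw [est1, htest, mul_zero]

theorem keyRate_le_keyRate {est est' : L2 (Idx N α β η) → ℝ≥0∞}
    {st st' : L2 (Idx N α β η) → CQ Q.Results η} {a b : ℝ≥0}
    (hest : ∀ Ψ ∈ attacks, b < est' Ψ → est' Ψ ≤ est Ψ + b)
    (hst : ∀ Ψ ∈ attacks, b < est' Ψ → ∀ ε₁ : ℝ≥0,
      smoothMinEntropy ε₁ (Q.processed (st Ψ)) ≤
        smoothMinEntropy (ε₁ + a) (Q.processed (st' Ψ))) (ε : ℝ≥0) :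
    Q.keyRate attacks est st ε ≤ Q.keyRate attacks est' st' (a + b + ε) := by
  refine iSup₂_le fun ε₁ ε₂ => iSup₂_le fun ε₃ hε => iSup_le fun hsec => ?_
  have hε' : (ε₁ + a) + ε₂ + (ε₃ + b) = a + b + ε := by rw [← hε]; ring
  refine le_iSup₂_of_le (ε₁ + a) ε₂ <| le_iSup₂_of_le (ε₃ + b) hε' <| le_iSup_of_le hsec <|
    EReal.div_le_div_right_of_nonneg (by exact_mod_cast N.zero_le) (EReal.sub_le_sub ?_ le_rfl)
  refine le_iInf₂ fun Ψ hΨ => le_iInf fun hlt => ?_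
  rw [ENNReal.coe_add] at hlt
  have hb : b < est' Ψ := le_add_self.trans_lt hlt
  have hε₃ : ε₃ < est Ψ := lt_of_add_lt_add_right (hlt.trans_le (hest Ψ hΨ hb))
  exact (iInf₂_le Ψ hΨ).trans <| (iInf_le _ hε₃).trans (hst Ψ hΨ hb ε₁)

theorem keyRate2_le_keyRate1 {a b : ℝ≥0}
    (hclose : ∀ Ψ ∈ attacks, b < Q.rangeProb Ψ → (Q.state1 Ψ).dist (Q.state2 Ψ) ≤ a) (ε : ℝ≥0) :
    Q.keyRate2 attacks ε ≤ Q.keyRate1 attacks (a + b + ε) := by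
  refine Q.keyRate_le_keyRate (fun _ _ _ => le_self_add) (fun Ψ hΨ hb ε₁ => ?_) ε
  have htot : (Q.state1 Ψ).total = 1 := Q.total_state1_eq_one (ne_bot_of_gt hb)
  have hle : (Q.state2 Ψ).total ≤ (Q.state1 Ψ).total :=
    (Q.total_measured_le_one _).trans_eq htot.symm
  have hdist : (Q.state2 Ψ).dist (Q.state1 Ψ) ≤ a * (Q.state1 Ψ).total := by
    rw [htot, mul_one, CQ.dist_comm]
    exact hclose Ψ hΨ (Q.lt_rangeProb_of_lt_est1 hb)
  exact CQ.smoothMinEntropy_process_le (Q.isPosTraceClass_measured _)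
    (Q.isPosTraceClass_measured _) hle hdist _

theorem keyRate2Own_le_keyRate2 {a : ℝ≥0} (hattacks : ∀ Ψ ∈ attacks, ‖Ψ‖ ≤ 1)
    (hclose : ∀ Ψ ∈ attacks, a < Q.rangeProb Ψ → (Q.state1 Ψ).dist (Q.state2 Ψ) ≤ a) (ε : ℝ≥0) :
    Q.keyRate2Own attacks ε ≤ Q.keyRate2 attacks (a + ε) := by
  have hest (Ψ) (hΨ : Ψ ∈ attacks) (ha : a < Q.est1 Ψ) :
      Q.est1 Ψ ≤ Q.testProb (Q.state2 Ψ) + a :=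
    calc Q.est1 Ψ ≤ Q.testProb (Q.state1 Ψ) := Q.est1_le_testProb (hattacks Ψ hΨ)
      _ ≤ Q.testProb (Q.state2 Ψ) + (Q.state1 Ψ).dist (Q.state2 Ψ) :=
          Q.testProb_le_testProb_add_dist _ _
      _ ≤ Q.testProb (Q.state2 Ψ) + a := by
          gcongr
          exact hclose Ψ hΨ (Q.lt_rangeProb_of_lt_est1 ha)
  simpa only [zero_add] using!
    Q.keyRate_le_keyRate (a := 0) hest (fun _ _ _ ε₁ => by rw [add_zero]) ε

end Scheme

end QKD

theorem theorem2 {N l : ℕ} [NeZero l] (hN : 0 < N) {α β η XK YK C : Type*}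
    (Q : QKD.Scheme N l α β XK YK C)
    (attacks : Set (QKD.L2 (QKD.Idx N α β η))) (hattacks : ∀ Ψ ∈ attacks, ‖Ψ‖ = 1)
    (δ ε : NNReal) (hδ : 0 < δ)
    (hclose : ∀ Ψ ∈ attacks, (δ : ℝ) ≤ Q.rangeProb Ψ →
      (Q.state1 Ψ).dist (Q.state2 Ψ) ≤ 2 * δ) :
    Q.keyRate2 attacks (2 * δ + ε) ≤ Q.keyRate1 attacks (5 * δ + ε) ∧
      Q.keyRate2Own attacks ε ≤ Q.keyRate2 attacks (2 * δ + ε) := by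
  constructor
  · have hbudget : 5 * δ + ε = 2 * δ + δ + (2 * δ + ε) := by ring
    rw [hbudget]
    exact Q.keyRate2_le_keyRate1 (fun Ψ hΨ hp => by exact_mod_cast hclose Ψ hΨ hp.le) _
  · have hδ2 : δ ≤ 2 * δ := le_mul_of_one_le_left' one_le_two
    exact Q.keyRate2Own_le_keyRate2 (fun Ψ hΨ => (hattacks Ψ hΨ).le) (fun Ψ hΨ hp => by
      exact_mod_cast hclose Ψ hΨ ((NNReal.coe_le_coe.2 hδ2).trans hp.le)) ε
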